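/- Let $\mathbb K=\{0,1\}^{\mathbb N}$ be the dyadic Cantor set with the metric $d(x,y)=2^{-n}$, where $n$ is the length of the longest common prefix of $x\ne y$. Let $I_n(x)$ be the cylinder of generation $n$ containing $x$, and $\mathcal F_n$ the set of the $2^n$ cylinders of generation $n$. For a Borel probability measure $\mu$ on $\mathbb K$ put $$\dim_*\mu=\inf\{\dim_{\mathcal H}E: E\subset\mathbb K \text{ Borel},\ \mu(E)>0\},\qquad \dim^*\mu=\inf\{\dim_{\mathcal H}E: E\subset\mathbb K\text{ Borel},\ \mu(\mathbb K\setminus E)=0\},$$ let $\mathrm{Dim}_*\mu$, $\mathrm{Dim}^*\mu$ be defined in the same way with the packing dimension in place of the Hausdorff dimension, and let $h_*(\mu)$, $h^*(\mu)$ be the lower and upper limits of $-\frac1n\sum_{I\in\mathcal F_n}\mu(I)\log\mu(I)$ as $n\to\infty$. The measure $\mu$ is exact if $\dim_*\mu=\dim^*\mu$, and dyadic doubling if there is a constant $C$ with $\mu(I_n(x))\le C\,\mu(I_{n+1}(x))$ for all $n\ge0$ and $x\in\mathbb K$. **Theorem.** For every $\varepsilon>0$ there are two dyadic doubling, exact Borel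 probability measures $\mu,\nu$ on $\mathbb K$ such that, with $$X_n(x)=\log\frac{\mu(I_n(x))}{\mu(I_{n-1}(x))},\qquad Y_n(x)=\log\frac{\nu(I_n(x))}{\nu(I_{n-1}(x))}\qquad(n\ge1),$$ one has $$\sup_{n\ge1}\|X_n-Y_n\|_\infty<\varepsilon\qquad\text{and nevertheless}\qquad |\dim_*\mu-\dim_*\nu|>\tfrac14 .$$ Moreover $\mu$ and $\nu$ can be chosen so that, in addition, each $m\in\{\mu,\nu\}$ satisfies $$\dim_*m=\dim^*m=\frac{h_*(m)}{\log 2}\qquad\text{and}\qquad \mathrm{Dim}_*m=\mathrm{Dim}^*m=\frac{h^*(m)}{\log2}.$$ Consequently the continuity of $\dim_*$ in the transition weights, which holds for measures defined by non-homogeneous Markov chains, fails for general measures: it is not true that for every $\eta>0$ there is $\zeta>0$ such that $|\dim_*\mu-\dim_*\nu|<\eta$ for all dyadic doubling, exact Borel probability measures $\mu,\nu$ on $\mathbb K$ with $$\sup_{n\ge1,\ x\in\mathbb K}\left|\frac{\mu(I_n(x))}{\mu(I_{n-1}(x))}-\frac{\nu(I_n(x))}{\nu(I_{n-1}(x))}\right|<\zeta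 .$$ -/

import Mathlib

open MeasureTheory Filter Topology
open scoped ENNReal NNReal

namespace DyadicCantor

/-- The limit set of the dyadic tree: infinite words in the digits `0` (`false`) and `1` (`true`). -/
abbrev Cantor : Type := ℕ → Bool

/-- The dyadic metric `d(x, y) = 2⁻ⁿ`, where `n` is the length of the longest common prefix of
`x ≠ y`. A cylinder of generation `n` has diameter `2⁻ⁿ`; the topology is the product topology. -/
noncomputable instance cantorMetric : MetricSpace Cantor :=
  PiNat.metricSpaceOfDiscreteUniformity fun _ => rfl

/-- The mass of `I_n(x)`, the cylinder of generation `n` that contains `x`. -/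
noncomputable def mass (μ : Measure Cantor) (n : ℕ) (x : Cantor) : ℝ :=
  μ.real (PiNat.cylinder x n)

/-- The cylinder of generation `n` that is coded by the finite word `w`. -/
def wordCylinder {n : ℕ} (w : Fin n → Bool) : Set Cantor :=
  {x | ∀ i : Fin n, x i = w i}

/-- Dyadic doubling: the mass of a cylinder is at most a constant times the mass of each of its two
children. -/
def IsDyadicDoubling (μ : Measure Cantor) : Prop :=
  ∃ C : ℝ≥0, ∀ (n : ℕ) (x : Cantor),
    μ (PiNat.cylinder x n) ≤ C * μ (PiNat.cylinder x (n + 1))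

/-- The transition weight `μ(I_n(x)) / μ(I_{n-1}(x))`, for `n ≥ 1` (it is trivial for `n = 0`). -/
noncomputable def weight (μ : Measure Cantor) (n : ℕ) (x : Cantor) : ℝ :=
  mass μ n x / mass μ (n - 1) x

/-- The random variable `X_n(x) = log (μ(I_n(x)) / μ(I_{n-1}(x)))`, for `n ≥ 1` (and `X_0 = 0`). -/
noncomputable def logRatio (μ : Measure Cantor) (n : ℕ) (x : Cantor) : ℝ :=
  Real.log (weight μ n x)

/-- The lower Hausdorff dimension `dim_* μ`. -/
noncomputable def lowerDim (μ : Measure Cantor) : ℝ≥0∞ :=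
  ⨅ (E : Set Cantor) (_ : MeasurableSet E) (_ : 0 < μ E), dimH E

/-- The upper Hausdorff dimension `dim^* μ`. -/
noncomputable def upperDim (μ : Measure Cantor) : ℝ≥0∞ :=
  ⨅ (E : Set Cantor) (_ : MeasurableSet E) (_ : μ Eᶜ = 0), dimH E

/-- A measure is exact if its lower and upper Hausdorff dimensions coincide. -/
def IsExact (μ : Measure Cantor) : Prop :=
  lowerDim μ = upperDim μ

/-- The number of cylinders of generation `n` that meet `E`. -/
noncomputable def boxCount (n : ℕ) (E : Set Cantor) : ℕ :=
  {w : Fin n → Bool | (E ∩ wordCylinder w).Nonempty}.ncard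

/-- The upper box-counting dimension. -/
noncomputable def upperBoxDim (E : Set Cantor) : ℝ≥0∞ :=
  limsup (fun n : ℕ => ENNReal.ofReal (Real.log (boxCount n E) / (n * Real.log 2))) atTop

/-- The packing (Tricot) dimension: the regularized (countably stable) upper box dimension. -/
noncomputable def packingDim (E : Set Cantor) : ℝ≥0∞ :=
  ⨅ (F : ℕ → Set Cantor) (_ : E ⊆ ⋃ i, F i), ⨆ i, upperBoxDim (F i)

/-- The lower packing dimension `Dim_* μ`. -/
noncomputable def lowerPackingDim (μ : Measure Cantor) : ℝ≥0∞ :=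
  ⨅ (E : Set Cantor) (_ : MeasurableSet E) (_ : 0 < μ E), packingDim E

/-- The upper packing dimension `Dim^* μ`. -/
noncomputable def upperPackingDim (μ : Measure Cantor) : ℝ≥0∞ :=
  ⨅ (E : Set Cantor) (_ : MeasurableSet E) (_ : μ Eᶜ = 0), packingDim E

/-- The normalized entropy `-(1/n) ∑ μ(I) log μ(I)` of the partition into the cylinders `I` of
generation `n`. -/
noncomputable def entropy (μ : Measure Cantor) (n : ℕ) : ℝ :=
  (-1 / (n : ℝ)) *
    ∑ w : Fin n → Bool, Real.log (μ.real (wordCylinder w)) * μ.real (wordCylinder w)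

/-- The lower entropy `h_*(μ)`. -/
noncomputable def lowerEntropy (μ : Measure Cantor) : ℝ :=
  liminf (entropy μ) atTop

/-- The upper entropy `h^*(μ)`. -/
noncomputable def upperEntropy (μ : Measure Cantor) : ℝ :=
  limsup (entropy μ) atTop

/-- `dim_* μ = dim^* μ = h_*(μ)` and `Dim_* μ = Dim^* μ = h^*(μ)`, with the entropies (which are
defined through natural logarithms) expressed in base `2`. -/
def DimensionsEqEntropies (μ : Measure Cantor) : Prop :=
  (lowerDim μ = upperDim μ ∧ upperDim μ = ENNReal.ofReal (lowerEntropy μ / Real.log 2)) ∧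
    (lowerPackingDim μ = upperPackingDim μ ∧
      upperPackingDim μ = ENNReal.ofReal (upperEntropy μ / Real.log 2))

end DyadicCantor

/-!
Digits at even positions are control bits: independent coins of bias `c` that drive a walk with
steps `±1`. The current sign of the walk selects, for each odd digit, either a fair coin or a coin
`p` of small entropy. By the law of large numbers the sign is eventually that of `c - 1/2`, so the
information content per digit tends to `(H(c) + log 2) / 2` if `c > 1/2` and to `(H(c) + H(p)) / 2`
if `c < 1/2`. Exchanging `c` slightly above `1/2` for `1 - c` changes every logarithmic transition
weight by at most `|log c - log (1 - c)|`, which is small, whereas the dimension drops by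
`(log 2 - H(p)) / (2 log 2)`, which is close to `1/2`.

The dimensions are read off from the almost sure limit of the information content per digit: from
below by the mass distribution principle, from above by counting cylinders of large mass. Dyadic
doubling bounds the information content, so its mean, the entropy, has the same limit.
-/

lemma measure_le_hausdorffMeasure_of_eball_le {X : Type*} [EMetricSpace X] [MeasurableSpace X]
    [BorelSpace X] {μ : Measure X} {F : Set X} {s : ℝ} {δ : ℝ≥0∞} (hδ : 0 < δ)
    (h : ∀ x ∈ F, ∀ r, 0 < r → r < δ → μ (Metric.eball x r) ≤ r ^ s) :
    μ F ≤ μH[s] F := by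
  obtain ⟨δ', hδ'0, hδ'⟩ := exists_between hδ
  have measure_inter_le (t : Set X) (ht : Metric.ediam t ≤ δ') :
      μ (F ∩ t) ≤ ⨆ _ : t.Nonempty, Metric.ediam t ^ s := by
    rcases (F ∩ t).eq_empty_or_nonempty with hempty | ⟨x, hxF, hxt⟩
    · simp [hempty]
    have hdiam : Metric.ediam t < δ := ht.trans_lt hδ'
    have hbound : ∀ᶠ r in 𝓝[>] Metric.ediam t, μ (F ∩ t) ≤ r ^ s := by
      filter_upwards [Ioo_mem_nhdsGT hdiam] with r hr
      refine (measure_mono fun y hy => ?_).trans (h x hxF r (pos_of_gt hr.1) hr.2)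
      exact (Metric.edist_le_ediam_of_mem hy.2 hxt).trans_lt hr.1
    have : (𝓝[>] Metric.ediam t).NeBot := nhdsGT_neBot_of_exists_gt ⟨δ, hdiam⟩
    rw [iSup_pos ⟨x, hxt⟩]
    exact ge_of_tendsto
      (ENNReal.continuous_rpow_const.continuousWithinAt (s := Set.Ioi _)) hbound
  rw [Measure.hausdorffMeasure_apply]
  refine le_iSup₂_of_le δ' hδ'0 (le_iInf₂ fun t hFt => le_iInf fun ht => ?_)
  calc μ F ≤ μ (⋃ n, F ∩ t n) := measure_mono (by rw [← Set.inter_iUnion]; simp [hFt])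
    _ ≤ ∑' n, μ (F ∩ t n) := measure_iUnion_le _
    _ ≤ ∑' n, ⨆ _ : (t n).Nonempty, Metric.ediam (t n) ^ s :=
      ENNReal.tsum_le_tsum fun n => measure_inter_le (t n) (ht n)

lemma iInf_pos_measure_le_iInf_conull {X α : Type*} [MeasurableSpace X] [CompleteLattice α]
    (μ : Measure X) [NeZero μ] (D : Set X → α) :
    ⨅ (E : Set X) (_ : MeasurableSet E) (_ : 0 < μ E), D E
      ≤ ⨅ (E : Set X) (_ : MeasurableSet E) (_ : μ Eᶜ = 0), D E := by
  refine iInf_mono fun E => iInf_mono fun _ => le_iInf fun hE => iInf_le _ ?_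
  refine pos_iff_ne_zero.2 fun h0 => NeZero.ne μ ?_
  rw [← Measure.measure_univ_eq_zero, ← Set.union_compl_self E]
  exact measure_union_null h0 hE

section Averages

lemma sum_range_eq_sum_even_add_sum_odd {M : Type*} [AddCommMonoid M] (v : ℕ → M) (n : ℕ) :
    ∑ i ∈ Finset.range n, v i
      = ∑ k ∈ Finset.range ((n + 1) / 2), v (2 * k)
        + ∑ k ∈ Finset.range (n / 2), v (2 * k + 1) := by
  induction n with
  | zero => simp
  | succ n ih =>
    rw [Finset.sum_range_succ, ih]
    rcases Nat.even_or_odd' n with ⟨m, rfl | rfl⟩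
    · rw [show (2 * m + 1 + 1) / 2 = m + 1 by omega, show (2 * m + 1) / 2 = m by omega,
        show 2 * m / 2 = m by omega, Finset.sum_range_succ, add_right_comm]
    · rw [show (2 * m + 1 + 1 + 1) / 2 = m + 1 by omega,
        show (2 * m + 1 + 1) / 2 = m + 1 by omega, show (2 * m + 1) / 2 = m by omega,
        Finset.sum_range_succ (fun k => v (2 * k + 1)), add_assoc]

lemma tendsto_sum_range_comp_div {v : ℕ → ℝ} {m : ℕ → ℕ} {a θ : ℝ}
    (hv : Tendsto (fun n : ℕ => (∑ k ∈ Finset.range n, v k) / n) atTop (𝓝 a))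
    (hm : Tendsto m atTop atTop) (hθ : Tendsto (fun n : ℕ => (m n : ℝ) / n) atTop (𝓝 θ)) :
    Tendsto (fun n : ℕ => (∑ k ∈ Finset.range (m n), v k) / n) atTop (𝓝 (a * θ)) := by
  refine ((hv.comp hm).mul hθ).congr' ?_
  filter_upwards [hm.eventually_gt_atTop 0] with n hn
  exact div_mul_div_cancel₀ (by exact_mod_cast hn.ne')

lemma tendsto_natCast_half_div :
    Tendsto (fun n : ℕ => ((n / 2 : ℕ) : ℝ) / n) atTop (𝓝 (1 / 2)) := by
  have h := (tendsto_nat_floor_mul_div_atTop (R := ℝ) (a := 1 / 2) (by norm_num)).comp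
    tendsto_natCast_atTop_atTop
  refine h.congr fun n => ?_
  rw [Function.comp_apply, one_div_mul_eq_div, ← Nat.cast_two (R := ℝ), Nat.floor_div_eq_div]

lemma tendsto_average_of_even_odd {v : ℕ → ℝ} {a b : ℝ}
    (ha : Tendsto (fun n : ℕ => (∑ k ∈ Finset.range n, v (2 * k)) / n) atTop (𝓝 a))
    (hb : Tendsto (fun n : ℕ => (∑ k ∈ Finset.range n, v (2 * k + 1)) / n) atTop (𝓝 b)) :
    Tendsto (fun n : ℕ => (∑ i ∈ Finset.range n, v i) / n) atTop (𝓝 ((a + b) / 2)) := by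
  have hodd := tendsto_sum_range_comp_div hb (Nat.tendsto_div_const_atTop two_ne_zero)
    tendsto_natCast_half_div
  have heven := tendsto_sum_range_comp_div (m := fun n => (n + 1) / 2) (θ := 1 / 2) ha
    ((Nat.tendsto_div_const_atTop two_ne_zero).comp (tendsto_add_atTop_nat 1)) ?_
  · simp only [sum_range_eq_sum_even_add_sum_odd v, add_div]
    convert heven.add hodd using 2
    ring
  · have hcompl : Tendsto (fun n : ℕ => 1 - ((n / 2 : ℕ) : ℝ) / n) atTop (𝓝 (1 / 2)) := by
      convert tendsto_natCast_half_div.const_sub 1 using 2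
      norm_num
    refine hcompl.congr' ?_
    filter_upwards [eventually_ne_atTop 0] with n hn
    have hsum : (n : ℝ) = (n / 2 : ℕ) + ((n + 1) / 2 : ℕ) := by norm_cast; omega
    have hn' : (n : ℝ) ≠ 0 := by exact_mod_cast hn
    rw [one_sub_div hn', sub_eq_of_eq_add' hsum]

lemma tendsto_average_congr {u v : ℕ → ℝ} {a : ℝ} (h : u =ᶠ[atTop] v)
    (hv : Tendsto (fun n : ℕ => (∑ i ∈ Finset.range n, v i) / n) atTop (𝓝 a)) :
    Tendsto (fun n : ℕ => (∑ i ∈ Finset.range n, u i) / n) atTop (𝓝 a) := by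
  have hdiff : Tendsto (fun n => u n - v n) atTop (𝓝 0) :=
    tendsto_const_nhds.congr' (h.mono fun n hn => by simp [hn])
  convert hdiff.cesaro.add hv using 2
  · rw [Finset.sum_sub_distrib, ← div_eq_inv_mul, ← add_div, sub_add_cancel]
  · rw [zero_add]

lemma eventually_pos_iff_of_tendsto_div {u : ℕ → ℝ} {a : ℝ}
    (h : Tendsto (fun n : ℕ => u n / n) atTop (𝓝 a)) (ha : a ≠ 0) :
    ∀ᶠ n in atTop, 0 < u n ↔ 0 < a := by
  rcases ha.lt_or_gt with ha | ha
  · filter_upwards [h.eventually_lt_const ha] with n hn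
    exact iff_of_false (fun hu => hn.not_ge (by positivity)) ha.not_gt
  · filter_upwards [h.eventually_const_lt ha] with n hn
    exact iff_of_true (lt_of_not_ge fun hu => hn.not_ge
      (div_nonpos_of_nonpos_of_nonneg hu n.cast_nonneg)) ha

lemma ae_tendsto_average_infinitePi {ι Ω : Type*} [MeasurableSpace Ω] {P : ι → Measure Ω}
    [∀ i, IsProbabilityMeasure (P i)] {j : ℕ → ι} (hj : Function.Injective j) {ν : Measure Ω}
    (hν : ∀ k, P (j k) = ν) {f : Ω → ℝ} (hf : Measurable f) (hfν : Integrable f ν) :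
    ∀ᵐ ω ∂Measure.infinitePi P,
      Tendsto (fun n : ℕ => (∑ k ∈ Finset.range n, f (ω (j k))) / n) atTop
        (𝓝 (∫ b, f b ∂ν)) := by
  have hcoord (k : ℕ) : MeasurePreserving (fun ω => ω (j k)) (Measure.infinitePi P) ν :=
    ⟨by fun_prop, (Measure.infinitePi_map_eval P (j k)).trans (hν k)⟩
  have hmap (k : ℕ) : (Measure.infinitePi P).map (fun ω => f (ω (j k))) = ν.map f := by
    rw [← (hcoord k).map_eq, Measure.map_map hf (hcoord k).measurable, Function.comp_def]
  have hmeas (k : ℕ) : AEMeasurable (fun ω : ι → Ω => f (ω (j k))) (Measure.infinitePi P) :=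
    (hf.comp (hcoord k).measurable).aemeasurable
  have hindep := ProbabilityTheory.iIndepFun_infinitePi (P := P) (X := fun _ => f) fun _ => hf
  have hmean : ∫ b, f b ∂ν = ∫ ω, f (ω (j 0)) ∂Measure.infinitePi P := by
    rw [← (hcoord 0).map_eq,
      integral_map (hcoord 0).aemeasurable hf.aestronglyMeasurable]
  rw [hmean]
  exact ProbabilityTheory.strong_law_ae_real (μ := Measure.infinitePi P)
    (fun k ω => f (ω (j k)))
    ((hcoord 0).integrable_comp_of_integrable hfν) (fun k l hkl => hindep.indepFun (hj.ne hkl))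
    (fun k => ⟨hmeas k, hmeas 0, (hmap k).trans (hmap 0).symm⟩)

end Averages

lemma sub_le_log_sub_log {a b : ℝ} (ha : 0 < a) (hab : a ≤ b) (hb : b ≤ 1) :
    b - a ≤ Real.log b - Real.log a := by
  have hb0 := ha.trans_le hab
  calc b - a ≤ (b - a) / b := le_div_self (sub_nonneg.2 hab) hb0 hb
    _ = 1 - (b / a)⁻¹ := by rw [inv_div, one_sub_div hb0.ne']
    _ ≤ Real.log (b / a) := Real.one_sub_inv_le_log_of_pos (div_pos hb0 ha)
    _ = Real.log b - Real.log a := Real.log_div hb0.ne' ha.ne'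

lemma abs_sub_le_abs_log_sub_log {a b : ℝ} (ha : a ∈ Set.Ioc 0 1) (hb : b ∈ Set.Ioc 0 1) :
    |a - b| ≤ |Real.log a - Real.log b| := by
  wlog hab : a ≤ b generalizing a b
  · rw [abs_sub_comm, abs_sub_comm (Real.log a)]
    exact this hb ha (le_of_not_ge hab)
  rw [abs_sub_comm, abs_sub_comm (Real.log a), abs_of_nonneg (sub_nonneg.2 hab)]
  exact (sub_le_log_sub_log ha.1 hab hb.2).trans (le_abs_self _)

namespace DyadicCantor

section Cylinders

variable {n : ℕ} {x y : Cantor} {w : Fin n → Bool}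

instance : BorelSpace Cantor := inferInstanceAs (BorelSpace (∀ _ : ℕ, Bool))

lemma edist_eq_of_ne (h : x ≠ y) : edist x y = (2⁻¹ : ℝ≥0∞) ^ PiNat.firstDiff x y := by
  have hdist : dist x y = (1 / 2 : ℝ) ^ PiNat.firstDiff x y := PiNat.dist_eq_of_ne h
  rw [edist_dist, hdist, ENNReal.ofReal_pow (by norm_num), one_div,
    ENNReal.ofReal_inv_of_pos two_pos, ENNReal.ofReal_ofNat]

lemma edist_le_of_mem_cylinder (h : y ∈ PiNat.cylinder x n) :
    edist x y ≤ (2⁻¹ : ℝ≥0∞) ^ n := by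
  rcases eq_or_ne x y with rfl | hne
  · simp
  · rw [PiNat.mem_cylinder_comm, PiNat.mem_cylinder_iff_le_firstDiff hne] at h
    rw [edist_eq_of_ne hne]
    exact pow_le_pow_right_of_le_one' (by simp) h

lemma lt_of_two_inv_pow_lt {m n : ℕ} (h : (2⁻¹ : ℝ≥0∞) ^ m < 2⁻¹ ^ n) : n < m :=
  lt_of_not_ge fun hmn => h.not_ge (pow_le_pow_right_of_le_one' (by simp) hmn)

lemma eball_subset_cylinder (x : Cantor) {r : ℝ≥0∞} (hr : r ≤ 2⁻¹ ^ n) :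
    Metric.eball x r ⊆ PiNat.cylinder x (n + 1) := by
  intro y hy
  rcases eq_or_ne y x with rfl | hne
  · exact PiNat.self_mem_cylinder y _
  · have hlt : (2⁻¹ : ℝ≥0∞) ^ PiNat.firstDiff y x < 2⁻¹ ^ n :=
      edist_eq_of_ne hne ▸ (Metric.mem_eball.1 hy).trans_le hr
    rw [PiNat.mem_cylinder_iff_le_firstDiff hne]
    exact lt_of_two_inv_pow_lt hlt

lemma wordCylinder_eq_cylinder (hx : x ∈ wordCylinder w) :
    wordCylinder w = PiNat.cylinder x n := by
  ext y
  rw [PiNat.mem_cylinder_iff]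
  exact ⟨fun h i hi => (h ⟨i, hi⟩).trans (hx ⟨i, hi⟩).symm, fun h i => (h i i.2).trans (hx i)⟩

lemma mem_wordCylinder_self (n : ℕ) (x : Cantor) :
    x ∈ wordCylinder (fun i : Fin n => x i) := fun _ => rfl

lemma preimage_prefix_singleton (w : Fin n → Bool) :
    (fun (x : Cantor) (i : Fin n) => x i) ⁻¹' {w} = wordCylinder w := by
  ext x
  simp [wordCylinder, funext_iff]

lemma measurable_prefix (n : ℕ) : Measurable fun (x : Cantor) (i : Fin n) => x i := by
  fun_prop

lemma measurableSet_wordCylinder (w : Fin n → Bool) : MeasurableSet (wordCylinder w) :=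
  preimage_prefix_singleton w ▸ measurable_prefix n (measurableSet_singleton w)

lemma measurableSet_cylinder (x : Cantor) (n : ℕ) : MeasurableSet (PiNat.cylinder x n) :=
  wordCylinder_eq_cylinder (mem_wordCylinder_self n x) ▸ measurableSet_wordCylinder _

lemma pairwise_disjoint_wordCylinder (n : ℕ) :
    Pairwise (Function.onFun Disjoint (wordCylinder (n := n))) := fun _ _ hvw =>
  Set.disjoint_left.2 fun _ hv hw => hvw (funext fun i => (hv i).symm.trans (hw i))

lemma ediam_wordCylinder_le (w : Fin n → Bool) :
    Metric.ediam (wordCylinder w) ≤ (2⁻¹ : ℝ≥0∞) ^ n := by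
  refine Metric.ediam_le fun x hx y hy => edist_le_of_mem_cylinder ?_
  rwa [← wordCylinder_eq_cylinder hx]

lemma ae_measure_cylinder_pos (μ : Measure Cantor) :
    ∀ᵐ x ∂μ, ∀ n, 0 < μ (PiNat.cylinder x n) := by
  refine ae_all_iff.2 fun n => measure_null_of_locally_null _ fun x hx => ?_
  exact ⟨PiNat.cylinder x n, mem_nhdsWithin_of_mem_nhds
    ((PiNat.isOpen_cylinder _ x n).mem_nhds (PiNat.self_mem_cylinder x n)),
    nonpos_iff_eq_zero.1 (not_lt.1 hx)⟩

end Cylinders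

section HausdorffDimension

variable {μ : Measure Cantor}

lemma measure_le_hausdorffMeasure_of_measure_cylinder_le {F : Set Cantor} {s : ℝ} (hs : 0 ≤ s)
    (N : ℕ) (h : ∀ x ∈ F, ∀ n ≥ N, μ (PiNat.cylinder x n) ≤ ((2⁻¹ : ℝ≥0∞) ^ n) ^ s) :
    μ F ≤ μH[s] F := by
  have hδ : (0 : ℝ≥0∞) < 2⁻¹ ^ N := ENNReal.pow_pos (by simp) N
  refine measure_le_hausdorffMeasure_of_eball_le hδ fun x hx r hr0 hrN => ?_
  obtain ⟨n, hn, hrn⟩ : ∃ n : ℕ, (2⁻¹ : ℝ≥0∞) ^ (n + 1) < r ∧ r ≤ 2⁻¹ ^ n := by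
    have hr1 : r ≤ 1 := hrN.le.trans (pow_le_one' (by simp) N)
    lift r to ℝ≥0 using (hr1.trans_lt ENNReal.one_lt_top).ne
    obtain ⟨n, hn⟩ := exists_nat_pow_near_of_lt_one (y := (2⁻¹ : ℝ≥0))
      (by exact_mod_cast hr0) (by exact_mod_cast hr1) (by norm_num)
      (inv_lt_one_of_one_lt₀ one_lt_two)
    rw [← ENNReal.coe_two, ← ENNReal.coe_inv two_ne_zero]
    exact ⟨n, by exact_mod_cast hn⟩
  have hNn : N < n + 1 := lt_of_two_inv_pow_lt (hn.trans hrN)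
  calc μ (Metric.eball x r) ≤ μ (PiNat.cylinder x (n + 1)) :=
      measure_mono (eball_subset_cylinder x hrn)
    _ ≤ ((2⁻¹ : ℝ≥0∞) ^ (n + 1)) ^ s := h x hx _ hNn.le
    _ ≤ r ^ s := ENNReal.rpow_le_rpow hn.le hs

lemma le_dimH_of_eventually_measure_cylinder_le {E : Set Cantor} (hE : μ E ≠ 0) {s : ℝ≥0}
    (h : ∀ x ∈ E, ∀ᶠ n in atTop, μ (PiNat.cylinder x n) ≤ ((2⁻¹ : ℝ≥0∞) ^ n) ^ (s : ℝ)) :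
    s ≤ dimH E := by
  let F (N : ℕ) : Set Cantor :=
    {x ∈ E | ∀ n ≥ N, μ (PiNat.cylinder x n) ≤ ((2⁻¹ : ℝ≥0∞) ^ n) ^ (s : ℝ)}
  have hcover : E ⊆ ⋃ N, F N := fun x hx =>
    let ⟨N, hN⟩ := eventually_atTop.1 (h x hx)
    Set.mem_iUnion.2 ⟨N, hx, hN⟩
  obtain ⟨N, hN⟩ := exists_measure_pos_of_not_measure_iUnion_null
    (mt (measure_mono_null hcover) hE)
  have hmeas : μ (F N) ≤ μH[s] (F N) :=
    measure_le_hausdorffMeasure_of_measure_cylinder_le s.coe_nonneg N fun x hx => hx.2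
  exact (le_dimH_of_hausdorffMeasure_ne_zero (hN.trans_le hmeas).ne').trans
    (dimH_mono (Set.sep_subset _ _))

lemma le_lowerDim_of_ae_eventually_measure_cylinder_le {s : ℝ≥0}
    (h : ∀ᵐ x ∂μ, ∀ᶠ n in atTop, μ (PiNat.cylinder x n) ≤ ((2⁻¹ : ℝ≥0∞) ^ n) ^ (s : ℝ)) :
    s ≤ lowerDim μ := by
  refine le_iInf₂ fun E _ => le_iInf fun hE => ?_
  have hgood := le_dimH_of_eventually_measure_cylinder_le
    ((measure_inter_conull h).trans_ne hE.ne') fun x hx => hx.2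
  exact hgood.trans (dimH_mono Set.inter_subset_left)

end HausdorffDimension

section BoxDimension

variable {μ : Measure Cantor} {E : Set Cantor}

lemma two_inv_pow_rpow (n : ℕ) (s : ℝ) :
    ((2⁻¹ : ℝ≥0∞) ^ n) ^ s = ENNReal.ofReal (Real.exp (-(n * (s * Real.log 2)))) := by
  have h : (2⁻¹ : ℝ≥0∞) = ENNReal.ofReal 2⁻¹ := by
    rw [ENNReal.ofReal_inv_of_pos two_pos, ENNReal.ofReal_ofNat]
  rw [h, ← ENNReal.ofReal_pow (by norm_num), ENNReal.ofReal_rpow_of_pos (by positivity),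
    Real.rpow_def_of_pos (by positivity), Real.log_pow, Real.log_inv]
  congr 2
  ring

lemma ofReal_log_div_le_iff {N n : ℕ} (hn : n ≠ 0) {s : ℝ≥0} :
    ENNReal.ofReal (Real.log N / (n * Real.log 2)) ≤ s
      ↔ N * ((2⁻¹ : ℝ≥0∞) ^ n) ^ (s : ℝ) ≤ 1 := by
  rcases N.eq_zero_or_pos with rfl | hN
  · simp
  have hN' : (0 : ℝ) < N := by exact_mod_cast hN
  have hn' : (0 : ℝ) < n := by exact_mod_cast hn.bot_lt
  rw [two_inv_pow_rpow, ← ENNReal.ofReal_natCast N, ← ENNReal.ofReal_mul hN'.le,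
    ENNReal.ofReal_le_one, Real.exp_neg, ← div_eq_mul_inv, div_le_one (Real.exp_pos _),
    ← Real.log_le_iff_le_exp hN', ← ENNReal.ofReal_coe_nnreal,
    ENNReal.ofReal_le_ofReal_iff s.coe_nonneg, div_le_iff₀ (mul_pos hn' (Real.log_pos one_lt_two)),
    mul_left_comm]

lemma hausdorffMeasure_le_liminf_boxCount (E : Set Cantor) {s : ℝ} (hs : 0 ≤ s) :
    μH[s] E ≤ liminf (fun n => boxCount n E * ((2⁻¹ : ℝ≥0∞) ^ n) ^ s) atTop := by
  classical
  let cover (n : ℕ) : Type := {w : Fin n → Bool | (E ∩ wordCylinder w).Nonempty}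
  have hcov := Measure.hausdorffMeasure_le_liminf_sum (l := atTop) (ι := cover) s E
    (fun n => (2⁻¹ : ℝ≥0∞) ^ n)
    (ENNReal.tendsto_pow_atTop_nhds_zero_of_lt_one (by simp)) (fun n w => wordCylinder w.1)
    (.of_forall fun n w => ediam_wordCylinder_le w.1)
    (.of_forall fun n x hx => Set.mem_iUnion.2
      ⟨⟨_, x, hx, mem_wordCylinder_self n x⟩, mem_wordCylinder_self n x⟩)
  refine hcov.trans (liminf_le_liminf (.of_forall fun n => ?_))
  calc ∑ w : cover n, Metric.ediam (wordCylinder w.1) ^ s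
      ≤ ∑ _w : cover n, ((2⁻¹ : ℝ≥0∞) ^ n) ^ s :=
        Finset.sum_le_sum fun w _ => ENNReal.rpow_le_rpow (ediam_wordCylinder_le w.1) hs
    _ = boxCount n E * ((2⁻¹ : ℝ≥0∞) ^ n) ^ s := by
        rw [Finset.sum_const, nsmul_eq_mul, Finset.card_univ, ← Nat.card_eq_fintype_card,
          boxCount, ← Nat.card_coe_set_eq]

lemma dimH_le_upperBoxDim (E : Set Cantor) : dimH E ≤ upperBoxDim E := by
  refine le_of_forall_gt_imp_ge_of_dense fun b hb => ?_
  induction b with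
  | top => exact le_top
  | coe s =>
    refine dimH_le_of_hausdorffMeasure_ne_top (ne_top_of_le_ne_top ENNReal.one_ne_top ?_)
    refine (hausdorffMeasure_le_liminf_boxCount E s.coe_nonneg).trans
      (liminf_le_of_frequently_le' (Eventually.frequently ?_))
    filter_upwards [eventually_lt_of_limsup_lt hb, eventually_ne_atTop 0] with n hn hn0
    exact (ofReal_log_div_le_iff hn0).1 hn.le

lemma dimH_le_packingDim (E : Set Cantor) : dimH E ≤ packingDim E :=
  le_iInf₂ fun F hF => calc
    dimH E ≤ dimH (⋃ i, F i) := dimH_mono hF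
    _ = ⨆ i, dimH (F i) := dimH_iUnion F
    _ ≤ ⨆ i, upperBoxDim (F i) := iSup_mono fun _ => dimH_le_upperBoxDim _

lemma boxCount_mul_le_measure_univ {n : ℕ} {a : ℝ≥0∞}
    (h : ∀ x ∈ E, a ≤ μ (PiNat.cylinder x n)) : boxCount n E * a ≤ μ Set.univ := by
  classical
  let words := Finset.univ.filter fun w : Fin n → Bool => (E ∩ wordCylinder w).Nonempty
  have hcard : boxCount n E = words.card := by
    rw [boxCount, ← Set.ncard_coe_finset, Finset.coe_filter_univ]
  have hmass (w : Fin n → Bool) (hw : w ∈ words) : a ≤ μ (wordCylinder w) := by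
    obtain ⟨x, hxE, hxw⟩ := (Finset.mem_filter.1 hw).2
    exact wordCylinder_eq_cylinder hxw ▸ h x hxE
  calc boxCount n E * a ≤ ∑ w ∈ words, μ (wordCylinder w) := by
        rw [hcard, ← nsmul_eq_mul]
        exact Finset.card_nsmul_le_sum _ _ _ hmass
    _ = μ (⋃ w ∈ words, wordCylinder w) :=
        (measure_biUnion_finset ((pairwise_disjoint_wordCylinder n).set_pairwise _)
          fun w _ => measurableSet_wordCylinder w).symm
    _ ≤ μ Set.univ := measure_mono (Set.subset_univ _)

lemma upperBoxDim_le_of_le_measure_cylinder [IsProbabilityMeasure μ] {s : ℝ≥0} {N : ℕ}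
    (h : ∀ x ∈ E, ∀ n ≥ N, ((2⁻¹ : ℝ≥0∞) ^ n) ^ (s : ℝ) ≤ μ (PiNat.cylinder x n)) :
    upperBoxDim E ≤ s := by
  refine limsup_le_of_le (by isBoundedDefault) ?_
  filter_upwards [eventually_ge_atTop N, eventually_ne_atTop 0] with n hn hn0
  rw [ofReal_log_div_le_iff hn0, ← measure_univ (μ := μ)]
  exact boxCount_mul_le_measure_univ fun x hx => h x hx n hn

lemma packingDim_le_of_eventually_le_measure_cylinder [IsProbabilityMeasure μ] {s : ℝ≥0}
    (h : ∀ x ∈ E, ∀ᶠ n in atTop, ((2⁻¹ : ℝ≥0∞) ^ n) ^ (s : ℝ) ≤ μ (PiNat.cylinder x n)) :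
    packingDim E ≤ s := by
  let F (N : ℕ) : Set Cantor :=
    {x | ∀ n ≥ N, ((2⁻¹ : ℝ≥0∞) ^ n) ^ (s : ℝ) ≤ μ (PiNat.cylinder x n)}
  have hcover : E ⊆ ⋃ N, F N := fun x hx => Set.mem_iUnion.2 (eventually_atTop.1 (h x hx))
  exact iInf₂_le_of_le F hcover
    (iSup_le fun N => upperBoxDim_le_of_le_measure_cylinder fun x hx => hx)

lemma upperPackingDim_le_of_ae_eventually_le_measure_cylinder [IsProbabilityMeasure μ] {s : ℝ≥0}
    (h : ∀ᵐ x ∂μ, ∀ᶠ n in atTop, ((2⁻¹ : ℝ≥0∞) ^ n) ^ (s : ℝ) ≤ μ (PiNat.cylinder x n)) :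
    upperPackingDim μ ≤ s := by
  obtain ⟨T, hT, hTmeas, hT0⟩ := exists_measurable_superset_of_null h
  refine iInf₂_le_of_le Tᶜ hTmeas.compl (iInf_le_of_le (by rwa [compl_compl]) ?_)
  exact packingDim_le_of_eventually_le_measure_cylinder fun x hx =>
    by_contra fun hcon => hx (hT hcon)

end BoxDimension

section LocalEntropy

variable {μ : Measure Cantor} {n : ℕ} {x : Cantor} {s h : ℝ}

/-- The normalized information content `-(1/n) log μ(I_n(x))` of the first `n` digits of `x`, whose
mean is the entropy and whose limit determines the dimensions of `μ`. It is `0` for `n = 0`. -/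
noncomputable def localEntropy (μ : Measure Cantor) (n : ℕ) (x : Cantor) : ℝ :=
  -Real.log (mass μ n x) / n

lemma mass_zero [IsProbabilityMeasure μ] (x : Cantor) : mass μ 0 x = 1 := by
  simp [mass]

lemma mass_le_one [IsProbabilityMeasure μ] (n : ℕ) (x : Cantor) : mass μ n x ≤ 1 :=
  measureReal_le_one

lemma mass_eq_wordCylinder (μ : Measure Cantor) (n : ℕ) (x : Cantor) :
    mass μ n x = μ.real (wordCylinder fun i : Fin n => x i) := by
  rw [mass, wordCylinder_eq_cylinder (mem_wordCylinder_self n x)]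

lemma measurable_localEntropy (μ : Measure Cantor) (n : ℕ) : Measurable (localEntropy μ n) := by
  have hmass : mass μ n = (fun w => μ.real (wordCylinder w)) ∘ fun x (i : Fin n) => x i :=
    funext fun x => mass_eq_wordCylinder μ n x
  have hmeas : Measurable (mass μ n) :=
    hmass ▸ Measurable.of_discrete.comp (measurable_prefix n)
  exact hmeas.log.neg.div_const _

lemma ae_mass_pos (μ : Measure Cantor) [IsFiniteMeasure μ] : ∀ᵐ x ∂μ, ∀ n, 0 < mass μ n x := by
  filter_upwards [ae_measure_cylinder_pos μ] with x hx n
  exact ENNReal.toReal_pos (hx n).ne' (measure_ne_top _ _)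

lemma measure_cylinder_le_iff_le_localEntropy [IsFiniteMeasure μ] (hn : n ≠ 0)
    (hx : 0 < mass μ n x) :
    μ (PiNat.cylinder x n) ≤ ((2⁻¹ : ℝ≥0∞) ^ n) ^ s ↔ s * Real.log 2 ≤ localEntropy μ n x := by
  have hn' : (0 : ℝ) < n := by exact_mod_cast hn.bot_lt
  rw [two_inv_pow_rpow, ← ofReal_measureReal, ENNReal.ofReal_le_ofReal_iff (Real.exp_nonneg _),
    ← mass, ← Real.log_le_iff_le_exp hx, localEntropy, le_div_iff₀' hn', le_neg]

lemma le_measure_cylinder_iff_localEntropy_le [IsFiniteMeasure μ] (hn : n ≠ 0)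
    (hx : 0 < mass μ n x) :
    ((2⁻¹ : ℝ≥0∞) ^ n) ^ s ≤ μ (PiNat.cylinder x n) ↔ localEntropy μ n x ≤ s * Real.log 2 := by
  have hn' : (0 : ℝ) < n := by exact_mod_cast hn.bot_lt
  rw [two_inv_pow_rpow, ← ofReal_measureReal, ENNReal.ofReal_le_ofReal_iff measureReal_nonneg,
    ← mass, ← Real.le_log_iff_exp_le hx, localEntropy, div_le_iff₀' hn', neg_le]

lemma ofReal_le_lowerDim [IsFiniteMeasure μ]
    (hlim : ∀ᵐ x ∂μ, Tendsto (localEntropy μ · x) atTop (𝓝 h)) :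
    ENNReal.ofReal (h / Real.log 2) ≤ lowerDim μ := by
  refine le_of_forall_lt_imp_le_of_dense fun c hc => ?_
  lift c to ℝ≥0 using hc.ne_top with s
  have hs : s * Real.log 2 < h := by
    rwa [← lt_div_iff₀ (Real.log_pos one_lt_two), ← Real.lt_toNNReal_iff_coe_lt,
      ← ENNReal.coe_lt_coe]
  refine le_lowerDim_of_ae_eventually_measure_cylinder_le ?_
  filter_upwards [hlim, ae_mass_pos μ] with x hx hpos
  filter_upwards [hx.eventually_const_lt hs, eventually_ne_atTop 0] with n hn hn0
  exact (measure_cylinder_le_iff_le_localEntropy hn0 (hpos n)).2 hn.le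

lemma upperPackingDim_le_ofReal [IsProbabilityMeasure μ]
    (hlim : ∀ᵐ x ∂μ, Tendsto (localEntropy μ · x) atTop (𝓝 h)) :
    upperPackingDim μ ≤ ENNReal.ofReal (h / Real.log 2) := by
  refine le_of_forall_gt_imp_ge_of_dense fun c hc => ?_
  induction c with
  | top => exact le_top
  | coe s =>
    have hs : h < s * Real.log 2 := by
      rw [← div_lt_iff₀ (Real.log_pos one_lt_two)]
      exact (Real.le_coe_toNNReal _).trans_lt (NNReal.coe_lt_coe.2 (ENNReal.coe_lt_coe.1 hc))
    refine upperPackingDim_le_of_ae_eventually_le_measure_cylinder ?_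
    filter_upwards [hlim, ae_mass_pos μ] with x hx hpos
    filter_upwards [hx.eventually_lt_const hs, eventually_ne_atTop 0] with n hn hn0
    exact (le_measure_cylinder_iff_localEntropy_le hn0 (hpos n)).2 hn.le

lemma lowerDim_le_upperDim (μ : Measure Cantor) [NeZero μ] : lowerDim μ ≤ upperDim μ :=
  iInf_pos_measure_le_iInf_conull μ dimH

lemma lowerPackingDim_le_upperPackingDim (μ : Measure Cantor) [NeZero μ] :
    lowerPackingDim μ ≤ upperPackingDim μ :=
  iInf_pos_measure_le_iInf_conull μ packingDim

lemma upperDim_le_upperPackingDim (μ : Measure Cantor) : upperDim μ ≤ upperPackingDim μ :=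
  iInf_mono fun E => iInf₂_mono fun _ _ => dimH_le_packingDim E

lemma lowerDim_le_lowerPackingDim (μ : Measure Cantor) : lowerDim μ ≤ lowerPackingDim μ :=
  iInf_mono fun E => iInf₂_mono fun _ _ => dimH_le_packingDim E

lemma integral_comp_prefix (μ : Measure Cantor) [IsFiniteMeasure μ] {n : ℕ}
    (f : (Fin n → Bool) → ℝ) :
    ∫ x, f (fun i : Fin n => x i) ∂μ = ∑ w, μ.real (wordCylinder w) * f w := by
  rw [← integral_map (f := f) (measurable_prefix n).aemeasurable
    Measurable.of_discrete.aestronglyMeasurable, integral_fintype .of_finite]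
  refine Finset.sum_congr rfl fun w _ => ?_
  rw [map_measureReal_apply (measurable_prefix n) (measurableSet_singleton w),
    preimage_prefix_singleton, smul_eq_mul]

lemma entropy_eq_integral_localEntropy (μ : Measure Cantor) [IsFiniteMeasure μ] (n : ℕ) :
    entropy μ n = ∫ x, localEntropy μ n x ∂μ := by
  simp_rw [entropy, localEntropy, mass_eq_wordCylinder, integral_div, integral_neg,
    integral_comp_prefix μ fun w => Real.log (μ.real (wordCylinder w)),
    mul_comm (Real.log _)]
  ring

end LocalEntropy

section Doubling

variable {μ : Measure Cantor} [IsProbabilityMeasure μ] {h : ℝ}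

lemma IsDyadicDoubling.exists_one_le_pow_mul_mass (hμ : IsDyadicDoubling μ) :
    ∃ C : ℝ, 1 ≤ C ∧ ∀ n x, 1 ≤ C ^ n * mass μ n x := by
  obtain ⟨C, hC⟩ := hμ
  refine ⟨max C 1, le_max_right _ _, fun n x => ?_⟩
  induction n with
  | zero => simp [mass_zero]
  | succ n ih =>
    have hdoubling : mass μ n x ≤ C * mass μ (n + 1) x := by
      have hreal := ENNReal.toReal_mono (by finiteness) (hC n x)
      rwa [ENNReal.toReal_mul] at hreal
    calc 1 ≤ max (C : ℝ) 1 ^ n * mass μ n x := ih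
      _ ≤ max (C : ℝ) 1 ^ n * (max (C : ℝ) 1 * mass μ (n + 1) x) := by
        gcongr
        exact hdoubling.trans (mul_le_mul_of_nonneg_right (le_max_left _ _) measureReal_nonneg)
      _ = max (C : ℝ) 1 ^ (n + 1) * mass μ (n + 1) x := by ring

lemma IsDyadicDoubling.mass_pos (hμ : IsDyadicDoubling μ) (n : ℕ) (x : Cantor) :
    0 < mass μ n x := by
  obtain ⟨C, hC1, hC⟩ := hμ.exists_one_le_pow_mul_mass
  exact pos_of_mul_pos_right (one_pos.trans_le (hC n x)) (by positivity)

lemma IsDyadicDoubling.exists_norm_localEntropy_le (hμ : IsDyadicDoubling μ) :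
    ∃ K : ℝ, ∀ n x, ‖localEntropy μ n x‖ ≤ K := by
  obtain ⟨C, hC1, hC⟩ := hμ.exists_one_le_pow_mul_mass
  refine ⟨Real.log C, fun n x => ?_⟩
  have hpos := hμ.mass_pos n x
  have hlog : 0 ≤ n * Real.log C + Real.log (mass μ n x) := by
    rw [← Real.log_pow, ← Real.log_mul (by positivity) hpos.ne']
    exact Real.log_nonneg (hC n x)
  have hnonneg : 0 ≤ -Real.log (mass μ n x) :=
    neg_nonneg.2 (Real.log_nonpos hpos.le (mass_le_one n x))
  rw [localEntropy, Real.norm_of_nonneg (div_nonneg hnonneg n.cast_nonneg)]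
  exact div_le_of_le_mul₀ n.cast_nonneg (Real.log_nonneg hC1) (by linarith)

lemma IsDyadicDoubling.tendsto_entropy (hμ : IsDyadicDoubling μ)
    (hlim : ∀ᵐ x ∂μ, Tendsto (localEntropy μ · x) atTop (𝓝 h)) :
    Tendsto (entropy μ) atTop (𝓝 h) := by
  obtain ⟨K, hK⟩ := hμ.exists_norm_localEntropy_le
  have hint := tendsto_integral_of_dominated_convergence (fun _ => K)
    (fun n => (measurable_localEntropy μ n).aestronglyMeasurable) (integrable_const K)
    (fun n => .of_forall (hK n)) hlim
  simpa [← entropy_eq_integral_localEntropy] using hint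

theorem IsDyadicDoubling.dimensions_of_tendsto_localEntropy (hμ : IsDyadicDoubling μ)
    (hlim : ∀ᵐ x ∂μ, Tendsto (localEntropy μ · x) atTop (𝓝 h)) :
    lowerDim μ = ENNReal.ofReal (h / Real.log 2) ∧ DimensionsEqEntropies μ := by
  have hle := ofReal_le_lowerDim hlim
  have hge := upperPackingDim_le_ofReal hlim
  have hD := lowerDim_le_upperDim μ
  have hP := lowerPackingDim_le_upperPackingDim μ
  have hDP := upperDim_le_upperPackingDim μ
  have hDP' := lowerDim_le_lowerPackingDim μ
  have hent := hμ.tendsto_entropy hlim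
  rw [DimensionsEqEntropies, lowerEntropy, upperEntropy, hent.liminf_eq, hent.limsup_eq]
  refine ⟨?_, ⟨?_, ?_⟩, ?_, ?_⟩ <;> order

end Doubling

section Steering

open ProbabilityTheory unitInterval

/-- The probability of the digit `b` under a coin that shows `1` with probability `p`. -/
noncomputable def coinWeight (p : I) (b : Bool) : ℝ :=
  if b then p else 1 - p

/-- The walk with steps `±1` driven by the control bits, which are the digits at the even
positions. -/
noncomputable def controlWalk (x : Cantor) (n : ℕ) : ℝ :=
  ∑ k ∈ Finset.range n, if x (2 * k) then 1 else -1

/-- The state that selects the coin for position `i`: at odd positions, whether the control walk is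
positive. It only depends on the control bits before `i`; at even positions it is `false`. -/
noncomputable def state (x : Cantor) (i : ℕ) : Bool :=
  if Even i then false else decide (0 < controlWalk x (i / 2 + 1))

/-- The digit sequence obtained from a family of coins `ω (i, b)` by using, at position `i`, the
coin that is selected by the state `b`. -/
noncomputable def steer (ω : ℕ × Bool → Bool) : Cantor :=
  fun i => ω (i, state (fun j => ω (j, false)) i)

/-- The law of a family of independent coins with biases `r`. -/
noncomputable def coinLaw (r : ℕ × Bool → I) : Measure (ℕ × Bool → Bool) :=
  Measure.infinitePi fun j => bernoulliMeasure true false (r j)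

/-- The law of the digit sequence steered through independent coins with biases `r`. -/
noncomputable def steeredMeasure (r : ℕ × Bool → I) : Measure Cantor :=
  (coinLaw r).map steer

variable {x y : Cantor} {i n : ℕ} {r : ℕ × Bool → I}

instance : IsProbabilityMeasure (coinLaw r) :=
  inferInstanceAs (IsProbabilityMeasure (Measure.infinitePi _))

lemma bernoulliMeasure_real_singleton (p : I) (b : Bool) :
    (bernoulliMeasure true false p).real {b} = coinWeight p b := by
  classical
  rw [bernoulliMeasure_real_apply p (measurableSet_singleton b)]
  cases b <;> simp [coinWeight]

lemma integral_neg_log_coinWeight (p : I) :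
    ∫ b, -Real.log (coinWeight p b) ∂bernoulliMeasure true false p = Real.binEntropy p := by
  rw [integral_bernoulliMeasure]
  simp [coinWeight, Real.binEntropy]

lemma state_congr (h : ∀ j < i, Even j → x j = y j) : state x i = state y i := by
  by_cases hi : Even i
  · simp only [state, if_pos hi]
  have hwalk : controlWalk x (i / 2 + 1) = controlWalk y (i / 2 + 1) := by
    refine Finset.sum_congr rfl fun k hk => ?_
    have hki : 2 * k < i := by grind
    rw [h (2 * k) hki (even_two_mul k)]
  simp only [state, hwalk]

lemma state_of_even (x : Cantor) (hi : Even i) : state x i = false := if_pos hi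

lemma steer_of_even (ω : ℕ × Bool → Bool) (hi : Even i) : steer ω i = ω (i, false) := by
  rw [steer, state_of_even _ hi]

lemma steer_apply (ω : ℕ × Bool → Bool) (i : ℕ) : steer ω i = ω (i, state (steer ω) i) := by
  rw [steer, state_congr fun _ _ hj => (steer_of_even ω hj).symm]

lemma measurable_state (i : ℕ) : Measurable fun x : Cantor => state x i := by
  have hwalk : Measurable fun x : Cantor => controlWalk x (i / 2 + 1) :=
    Finset.measurable_fun_sum _ fun k _ =>
      (Measurable.of_discrete (f := fun b : Bool => if b then (1 : ℝ) else -1)).comp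
        (measurable_pi_apply (2 * k))
  by_cases hi : Even i
  · simp only [state_of_even _ hi, measurable_const]
  · simp only [state, if_neg hi]
    exact measurable_to_bool (by simpa [Set.preimage] using measurableSet_lt measurable_const hwalk)

lemma measurable_steer : Measurable steer := by
  refine measurable_pi_lambda _ fun i => ?_
  have hstate : Measurable fun ω : ℕ × Bool → Bool => state (fun j => ω (j, false)) i :=
    (measurable_state i).comp (measurable_pi_lambda _ fun j => measurable_pi_apply _)
  have hselect : Measurable fun q : (ℕ × Bool → Bool) × Bool => q.1 (i, q.2) :=
    measurable_from_prod_countable_left fun b => measurable_pi_apply (i, b)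
  exact hselect.comp (measurable_id.prodMk hstate)

instance : IsProbabilityMeasure (steeredMeasure r) :=
  Measure.isProbabilityMeasure_map measurable_steer.aemeasurable

lemma steer_mem_cylinder_iff (ω : ℕ × Bool → Bool) (x : Cantor) (n : ℕ) :
    steer ω ∈ PiNat.cylinder x n ↔ ∀ i < n, ω (i, state x i) = x i := by
  rw [PiNat.mem_cylinder_iff]
  constructor
  · intro h i hi
    rw [← h i hi, steer_apply, state_congr fun j hj _ => (h j (hj.trans hi)).symm]
  · intro h i hi
    rw [steer_apply, ← h i hi, state_congr (y := x)]
    intro j hj hjeven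
    rw [steer_of_even ω hjeven, ← h j (hj.trans hi), state_of_even x hjeven]

lemma mass_steeredMeasure (r : ℕ × Bool → I) (n : ℕ) (x : Cantor) :
    mass (steeredMeasure r) n x
      = ∏ i ∈ Finset.range n, coinWeight (r (i, state x i)) (x i) := by
  have hpre : steer ⁻¹' PiNat.cylinder x n
      = Set.pi ((Finset.range n).image fun i => (i, state x i) : Finset (ℕ × Bool))
        fun j => {x j.1} := by
    ext ω
    rw [Set.mem_preimage, steer_mem_cylinder_iff]
    simp [Set.mem_pi]
  rw [mass, steeredMeasure, map_measureReal_apply measurable_steer (measurableSet_cylinder x n),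
    hpre, measureReal_def, coinLaw, Measure.infinitePi_pi _ fun _ _ => measurableSet_singleton _,
    Finset.prod_image fun i _ k _ h => congrArg Prod.fst h, ENNReal.toReal_prod]
  exact Finset.prod_congr rfl fun i _ => bernoulliMeasure_real_singleton _ _

lemma mass_steeredMeasure_succ (r : ℕ × Bool → I) (n : ℕ) (x : Cantor) :
    mass (steeredMeasure r) (n + 1) x
      = mass (steeredMeasure r) n x * coinWeight (r (n, state x n)) (x n) := by
  rw [mass_steeredMeasure, Finset.prod_range_succ, ← mass_steeredMeasure]

lemma isDyadicDoubling_steeredMeasure {δ : ℝ} (hδ : 0 < δ)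
    (hr : ∀ j b, δ ≤ coinWeight (r j) b) : IsDyadicDoubling (steeredMeasure r) := by
  refine ⟨Real.toNNReal δ⁻¹, fun n x => ?_⟩
  rw [← ofReal_measureReal, ← ofReal_measureReal, ← ENNReal.ofReal,
    ← ENNReal.ofReal_mul (inv_nonneg.2 hδ.le)]
  refine ENNReal.ofReal_le_ofReal ?_
  change mass _ n x ≤ δ⁻¹ * mass _ (n + 1) x
  rw [← div_eq_inv_mul, le_div_iff₀ hδ, mass_steeredMeasure_succ]
  exact mul_le_mul_of_nonneg_left (hr _ _) measureReal_nonneg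

lemma weight_steeredMeasure_succ (hr : ∀ j b, 0 < coinWeight (r j) b) (n : ℕ) (x : Cantor) :
    weight (steeredMeasure r) (n + 1) x = coinWeight (r (n, state x n)) (x n) := by
  have hpos : 0 < mass (steeredMeasure r) n x :=
    mass_steeredMeasure r n x ▸ Finset.prod_pos fun i _ => hr _ _
  rw [weight, Nat.add_sub_cancel, mass_steeredMeasure_succ, mul_div_cancel_left₀ _ hpos.ne']

lemma abs_logRatio_steeredMeasure_sub_le {r' : ℕ × Bool → I} {κ : ℝ}
    (hr : ∀ j b, 0 < coinWeight (r j) b) (hr' : ∀ j b, 0 < coinWeight (r' j) b)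
    (h : ∀ j b, |Real.log (coinWeight (r j) b) - Real.log (coinWeight (r' j) b)| ≤ κ)
    (n : ℕ) (x : Cantor) :
    |logRatio (steeredMeasure r) n x - logRatio (steeredMeasure r') n x| ≤ κ := by
  cases n with
  | zero => simpa [logRatio, weight, mass_zero] using (abs_nonneg _).trans (h (0, false) false)
  | succ n =>
    rw [logRatio, logRatio, weight_steeredMeasure_succ hr, weight_steeredMeasure_succ hr']
    exact h _ _

lemma localEntropy_steeredMeasure (hr : ∀ j b, 0 < coinWeight (r j) b) (n : ℕ) (x : Cantor) :
    localEntropy (steeredMeasure r) n x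
      = (∑ i ∈ Finset.range n, -Real.log (coinWeight (r (i, state x i)) (x i))) / n := by
  rw [localEntropy, mass_steeredMeasure, Real.log_prod fun i _ => (hr _ _).ne',
    Finset.sum_neg_distrib]

lemma ae_tendsto_average_coinLaw {j : ℕ → ℕ × Bool} (hj : Function.Injective j) {p : I}
    (hr : ∀ k, r (j k) = p) (f : Bool → ℝ) :
    ∀ᵐ ω ∂coinLaw r, Tendsto (fun n : ℕ => (∑ k ∈ Finset.range n, f (ω (j k))) / n) atTop
      (𝓝 (∫ b, f b ∂bernoulliMeasure true false p)) :=
  ae_tendsto_average_infinitePi hj (fun k => by rw [hr]) .of_discrete .of_finite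

lemma ae_eventually_state {c : I} (hcontrol : ∀ k, r (2 * k, false) = c) (hc : (c : ℝ) ≠ 1 / 2) :
    ∀ᵐ ω ∂coinLaw r, ∀ᶠ i in atTop,
      state (steer ω) i = if Even i then false else decide (1 / 2 < (c : ℝ)) := by
  have hlln := ae_tendsto_average_coinLaw (j := fun k => (2 * k, false))
    (fun k l h => by simpa using h) hcontrol (fun b => if b then (1 : ℝ) else -1)
  have hmean : ∫ b, (if b then (1 : ℝ) else -1) ∂bernoulliMeasure true false c = 2 * c - 1 := by
    rw [integral_bernoulliMeasure]
    simp
    ring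
  filter_upwards [hlln] with ω hω
  have hdrift : Tendsto (fun n : ℕ => controlWalk (steer ω) n / n) atTop (𝓝 (2 * c - 1)) := by
    simpa only [controlWalk, steer_of_even ω (even_two_mul _), hmean] using hω
  have hsign := eventually_pos_iff_of_tendsto_div hdrift (by grind)
  have htime : Tendsto (fun i : ℕ => i / 2 + 1) atTop atTop :=
    (tendsto_add_atTop_nat 1).comp (Nat.tendsto_div_const_atTop two_ne_zero)
  filter_upwards [htime.eventually hsign] with i hi
  have hpos : 0 < 2 * (c : ℝ) - 1 ↔ 1 / 2 < (c : ℝ) := by grind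
  rw [state, decide_eq_decide.2 (hi.trans hpos)]

lemma ae_tendsto_localEntropy_steeredMeasure {c q : I} (hr : ∀ j b, 0 < coinWeight (r j) b)
    (hc : (c : ℝ) ≠ 1 / 2) (hcontrol : ∀ k, r (2 * k, false) = c)
    (hselected : ∀ k, r (2 * k + 1, decide (1 / 2 < (c : ℝ))) = q) :
    ∀ᵐ x ∂steeredMeasure r, Tendsto (localEntropy (steeredMeasure r) · x) atTop
      (𝓝 ((Real.binEntropy c + Real.binEntropy q) / 2)) := by
  refine (ae_map_iff measurable_steer.aemeasurable
    (measurableSet_tendsto _ (measurable_localEntropy (steeredMeasure r)))).2 ?_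
  have heven := ae_tendsto_average_coinLaw (j := fun k => (2 * k, false))
    (fun k l h => by simpa using h) hcontrol fun b => -Real.log (coinWeight c b)
  have hodd := ae_tendsto_average_coinLaw (j := fun k => (2 * k + 1, decide (1 / 2 < (c : ℝ))))
    (fun k l h => by simpa using h) hselected fun b => -Real.log (coinWeight q b)
  rw [integral_neg_log_coinWeight] at heven hodd
  filter_upwards [heven, hodd, ae_eventually_state hcontrol hc] with ω hωeven hωodd hstate
  simp_rw [localEntropy_steeredMeasure hr]
  let j (i : ℕ) : ℕ × Bool := (i, if Even i then false else decide (1 / 2 < (c : ℝ)))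
  refine tendsto_average_congr (v := fun i => -Real.log (coinWeight (r (j i)) (ω (j i))))
    (hstate.mono fun i hi => ?_) (tendsto_average_of_even_odd ?_ ?_)
  · simp only [j, ← hi, ← steer_apply]
  · simpa [j, hcontrol] using hωeven
  · simpa only [j, Nat.not_even_bit1, if_false, hselected] using hωodd

end Steering

section Switching

open unitInterval

/-- The coin biases of a switched measure: control bits have bias `c`, and the digit at an odd
position has bias `q b` if the control walk is in the state `b`. -/
noncomputable def switchBias (c : I) (q : Bool → I) (j : ℕ × Bool) : I :=
  if Even j.1 then c else q j.2

/-- The steered measure in which the sign of a walk driven by control bits of bias `c` switches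
between the biases `q true` and `q false` of the remaining digits. -/
noncomputable def switchedMeasure (c : I) (q : Bool → I) : Measure Cantor :=
  steeredMeasure (switchBias c q)

variable {c p : I} {q : Bool → I}

instance : IsProbabilityMeasure (switchedMeasure c q) :=
  inferInstanceAs (IsProbabilityMeasure (steeredMeasure _))

lemma symm_mem_Ioo (hp : p ∈ Set.Ioo 0 1) : σ p ∈ Set.Ioo 0 1 :=
  ⟨show (0 : ℝ) < 1 - p from sub_pos.2 hp.2, show (1 - p : ℝ) < 1 from sub_lt_self 1 hp.1⟩

lemma min_le_coinWeight (p : I) (b : Bool) : min (p : ℝ) (1 - p) ≤ coinWeight p b := by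
  cases b <;> simp [coinWeight]

lemma exists_pos_le_coinWeight_switchBias (hc : c ∈ Set.Ioo 0 1) (hq : ∀ b, q b ∈ Set.Ioo 0 1) :
    ∃ δ : ℝ, 0 < δ ∧ ∀ j b, δ ≤ coinWeight (switchBias c q j) b := by
  let m (p : I) : ℝ := min (p : ℝ) (1 - p)
  have hm {p : I} (hp : p ∈ Set.Ioo 0 1) : 0 < m p := lt_min hp.1 (sub_pos.2 hp.2)
  refine ⟨min (m c) (min (m (q true)) (m (q false))),
    lt_min (hm hc) (lt_min (hm (hq true)) (hm (hq false))), fun j b => ?_⟩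
  refine le_trans ?_ (min_le_coinWeight _ b)
  obtain ⟨i, s⟩ := j
  by_cases hi : Even i
  · simp [switchBias, hi, m]
  · cases s <;> simp [switchBias, hi, m]

lemma coinWeight_switchBias_pos (hc : c ∈ Set.Ioo 0 1) (hq : ∀ b, q b ∈ Set.Ioo 0 1)
    (j : ℕ × Bool) (b : Bool) : 0 < coinWeight (switchBias c q j) b :=
  let ⟨_, hδ, hle⟩ := exists_pos_le_coinWeight_switchBias hc hq
  hδ.trans_le (hle j b)

lemma isDyadicDoubling_switchedMeasure (hc : c ∈ Set.Ioo 0 1) (hq : ∀ b, q b ∈ Set.Ioo 0 1) :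
    IsDyadicDoubling (switchedMeasure c q) :=
  let ⟨_, hδ, hle⟩ := exists_pos_le_coinWeight_switchBias hc hq
  isDyadicDoubling_steeredMeasure hδ hle

lemma dimensions_switchedMeasure (hc : c ∈ Set.Ioo 0 1) (hq : ∀ b, q b ∈ Set.Ioo 0 1)
    (hhalf : (c : ℝ) ≠ 1 / 2) :
    lowerDim (switchedMeasure c q) = ENNReal.ofReal
        ((Real.binEntropy c + Real.binEntropy (q (decide (1 / 2 < (c : ℝ))))) / 2 / Real.log 2) ∧
      DimensionsEqEntropies (switchedMeasure c q) :=
  (isDyadicDoubling_switchedMeasure hc hq).dimensions_of_tendsto_localEntropy <|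
    ae_tendsto_localEntropy_steeredMeasure (coinWeight_switchBias_pos hc hq) hhalf
      (fun k => if_pos (even_two_mul k)) fun k => if_neg (Nat.not_even_bit1 k)

lemma abs_log_coinWeight_switchBias_symm_sub_le (c : I) (q : Bool → I) (j : ℕ × Bool) (b : Bool) :
    |Real.log (coinWeight (switchBias c q j) b) - Real.log (coinWeight (switchBias (σ c) q j) b)|
      ≤ |Real.log c - Real.log (1 - c)| := by
  by_cases hj : Even j.1
  · cases b <;> simp [switchBias, hj, coinWeight, abs_sub_comm]
  · simp [switchBias, hj]

lemma abs_logRatio_switchedMeasure_symm_sub_le (hc : c ∈ Set.Ioo 0 1)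
    (hq : ∀ b, q b ∈ Set.Ioo 0 1) (n : ℕ) (x : Cantor) :
    |logRatio (switchedMeasure c q) n x - logRatio (switchedMeasure (σ c) q) n x|
      ≤ |Real.log c - Real.log (1 - c)| :=
  abs_logRatio_steeredMeasure_sub_le (coinWeight_switchBias_pos hc hq)
    (coinWeight_switchBias_pos (symm_mem_Ioo hc) hq)
    (abs_log_coinWeight_switchBias_symm_sub_le c q) n x

lemma toReal_lowerDim_switchedMeasure_sub_symm (hc : c ∈ Set.Ioo 0 1)
    (hq : ∀ b, q b ∈ Set.Ioo 0 1) (hhalf : 1 / 2 < (c : ℝ)) :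
    (lowerDim (switchedMeasure c q)).toReal - (lowerDim (switchedMeasure (σ c) q)).toReal
      = (Real.binEntropy (q true) - Real.binEntropy (q false)) / 2 / Real.log 2 := by
  have hsymm : (σ c : ℝ) < 1 / 2 := by rw [coe_symm_eq]; linarith
  have hnonneg (p p' : I) :
      0 ≤ (Real.binEntropy p + Real.binEntropy p') / 2 / Real.log 2 := by
    have hp := Real.binEntropy_nonneg p.2.1 p.2.2
    have hp' := Real.binEntropy_nonneg p'.2.1 p'.2.2
    positivity
  rw [(dimensions_switchedMeasure hc hq hhalf.ne').1,
    (dimensions_switchedMeasure (symm_mem_Ioo hc) hq hsymm.ne).1,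
    ENNReal.toReal_ofReal (hnonneg _ _), ENNReal.toReal_ofReal (hnonneg _ _),
    decide_eq_true hhalf, decide_eq_false hsymm.not_gt, coe_symm_eq, Real.binEntropy_one_sub]
  ring

lemma exists_binEntropy_lt {a : ℝ} (ha : 0 < a) :
    ∃ p ∈ Set.Ioo (0 : I) 1, Real.binEntropy p < a := by
  have h : ∀ᶠ p in 𝓝[>] (0 : ℝ), Real.binEntropy p < a :=
    Real.binEntropy_continuous.continuousWithinAt.eventually_lt_const (by simpa using ha)
  obtain ⟨p, hp, hp0, hp1⟩ := (h.and (Ioo_mem_nhdsGT one_pos)).exists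
  exact ⟨⟨p, hp0.le, hp1.le⟩, ⟨hp0, hp1⟩, hp⟩

lemma exists_half_lt_abs_log_sub_log_lt {ε : ℝ} (hε : 0 < ε) :
    ∃ c ∈ Set.Ioo (0 : I) 1, 1 / 2 < (c : ℝ) ∧ |Real.log c - Real.log (1 - c)| < ε := by
  have hcont : ContinuousAt (fun c : ℝ => |Real.log c - Real.log (1 - c)|) (1 / 2) := by
    fun_prop (disch := norm_num)
  have h : ∀ᶠ c in 𝓝[>] (1 / 2 : ℝ), |Real.log c - Real.log (1 - c)| < ε :=
    hcont.continuousWithinAt.eventually_lt_const (by norm_num [hε])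
  obtain ⟨c, hcε, hhalf, hc1⟩ := (h.and (Ioo_mem_nhdsGT one_half_lt_one)).exists
  have hc0 : 0 < c := one_half_pos.trans hhalf
  exact ⟨⟨c, hc0.le, hc1.le⟩, ⟨hc0, hc1⟩, hhalf, hcε⟩

theorem exists_close_logRatio_distant_lowerDim {ε κ : ℝ} (hε : 0 < ε) (hκ : κ < 1 / 2) :
    ∃ μ ν : Measure Cantor, IsProbabilityMeasure μ ∧ IsProbabilityMeasure ν ∧
      IsDyadicDoubling μ ∧ IsDyadicDoubling ν ∧ IsExact μ ∧ IsExact ν ∧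
      DimensionsEqEntropies μ ∧ DimensionsEqEntropies ν ∧
      (⨆ (n : ℕ) (x : Cantor), ‖logRatio μ n x - logRatio ν n x‖ₑ) < ENNReal.ofReal ε ∧
      κ < |(lowerDim μ).toReal - (lowerDim ν).toReal| := by
  have hlog : 0 < Real.log 2 := Real.log_pos one_lt_two
  obtain ⟨p, hp, hpκ⟩ := exists_binEntropy_lt (mul_pos (by linarith : 0 < 1 - 2 * κ) hlog)
  obtain ⟨c, hc, hhalf, hcε⟩ := exists_half_lt_abs_log_sub_log_lt hε
  let fair : I := ⟨2⁻¹, by norm_num, by norm_num⟩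
  let q (b : Bool) : I := if b then fair else p
  have hfair : fair ∈ Set.Ioo 0 1 :=
    ⟨show (0 : ℝ) < 2⁻¹ by norm_num, show (2⁻¹ : ℝ) < 1 by norm_num⟩
  have hq (b : Bool) : q b ∈ Set.Ioo 0 1 := by cases b <;> assumption
  have hc' := symm_mem_Ioo hc
  have hsymm : (σ c : ℝ) ≠ 1 / 2 := by rw [coe_symm_eq]; linarith
  have hdim := (dimensions_switchedMeasure hc hq hhalf.ne').2
  have hdim' := (dimensions_switchedMeasure hc' hq hsymm).2
  refine ⟨switchedMeasure c q, switchedMeasure (σ c) q, inferInstance, inferInstance,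
    isDyadicDoubling_switchedMeasure hc hq, isDyadicDoubling_switchedMeasure hc' hq,
    hdim.1.1, hdim'.1.1, hdim, hdim', ?_, ?_⟩
  · refine (iSup₂_le fun n x => ?_).trans_lt ((ENNReal.ofReal_lt_ofReal_iff hε).2 hcε)
    rw [Real.enorm_eq_ofReal_abs]
    exact ENNReal.ofReal_le_ofReal (abs_logRatio_switchedMeasure_symm_sub_le hc hq n x)
  · calc κ < (Real.log 2 - Real.binEntropy p) / 2 / Real.log 2 := by
          rw [lt_div_iff₀ hlog]
          linarith
      _ = (Real.binEntropy (q true) - Real.binEntropy (q false)) / 2 / Real.log 2 := by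
          rw [← Real.binEntropy_two_inv]
          rfl
      _ = (lowerDim (switchedMeasure c q)).toReal - (lowerDim (switchedMeasure (σ c) q)).toReal :=
          (toReal_lowerDim_switchedMeasure_sub_symm hc hq hhalf).symm
      _ ≤ _ := le_abs_self _

end Switching

lemma IsDyadicDoubling.weight_mem_Ioc {μ : Measure Cantor} [IsProbabilityMeasure μ]
    (hμ : IsDyadicDoubling μ) (n : ℕ) (x : Cantor) : weight μ n x ∈ Set.Ioc 0 1 :=
  ⟨div_pos (hμ.mass_pos _ _) (hμ.mass_pos _ _),
    div_le_one_of_le₀ (measureReal_mono (PiNat.cylinder_anti x (n.sub_le 1))) measureReal_nonneg⟩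

lemma enorm_weight_sub_le_enorm_logRatio_sub {μ ν : Measure Cantor} [IsProbabilityMeasure μ]
    [IsProbabilityMeasure ν] (hμ : IsDyadicDoubling μ) (hν : IsDyadicDoubling ν) (n : ℕ)
    (x : Cantor) : ‖weight μ n x - weight ν n x‖ₑ ≤ ‖logRatio μ n x - logRatio ν n x‖ₑ :=
  enorm_le_iff_norm_le.2
    (abs_sub_le_abs_log_sub_log (hμ.weight_mem_Ioc n x) (hν.weight_mem_Ioc n x))

end DyadicCantor

theorem mainTheorem4 :
    (∀ ε : ℝ, 0 < ε →
      ∃ μ ν : Measure DyadicCantor.Cantor,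
        IsProbabilityMeasure μ ∧ IsProbabilityMeasure ν ∧
        DyadicCantor.IsDyadicDoubling μ ∧ DyadicCantor.IsDyadicDoubling ν ∧
        DyadicCantor.IsExact μ ∧ DyadicCantor.IsExact ν ∧
        DyadicCantor.DimensionsEqEntropies μ ∧ DyadicCantor.DimensionsEqEntropies ν ∧
        (⨆ (n : ℕ) (x : DyadicCantor.Cantor),
          ‖DyadicCantor.logRatio μ n x - DyadicCantor.logRatio ν n x‖ₑ) < ENNReal.ofReal ε ∧
        1 / 4 < |(DyadicCantor.lowerDim μ).toReal - (DyadicCantor.lowerDim ν).toReal|) ∧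
    ¬ (∀ η : ℝ, 0 < η → ∃ ζ : ℝ, 0 < ζ ∧
      ∀ μ ν : Measure DyadicCantor.Cantor,
        IsProbabilityMeasure μ → IsProbabilityMeasure ν →
        DyadicCantor.IsDyadicDoubling μ → DyadicCantor.IsDyadicDoubling ν →
        DyadicCantor.IsExact μ → DyadicCantor.IsExact ν →
        (⨆ (n : ℕ) (x : DyadicCantor.Cantor),
          ‖DyadicCantor.weight μ n x - DyadicCantor.weight ν n x‖ₑ) < ENNReal.ofReal ζ →
        |(DyadicCantor.lowerDim μ).toReal - (DyadicCantor.lowerDim ν).toReal| < η) := by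
  refine ⟨fun ε hε => DyadicCantor.exists_close_logRatio_distant_lowerDim hε (by norm_num),
    fun hcont => ?_⟩
  obtain ⟨ζ, hζ, h⟩ := hcont (1 / 4) (by norm_num)
  obtain ⟨μ, ν, hμ, hν, hdμ, hdν, hxμ, hxν, -, -, hclose, hfar⟩ :=
    DyadicCantor.exists_close_logRatio_distant_lowerDim (κ := 1 / 4) hζ (by norm_num)
  have hweight : (⨆ (n : ℕ) (x : DyadicCantor.Cantor),
      ‖DyadicCantor.weight μ n x - DyadicCantor.weight ν n x‖ₑ) < ENNReal.ofReal ζ :=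
    (iSup₂_mono fun n x =>
      DyadicCantor.enorm_weight_sub_le_enorm_logRatio_sub hdμ hdν n x).trans_lt hclose
  exact (h μ ν hμ hν hdμ hdν hxμ hxν hweight).not_gt hfar
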